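/- Let $n\in\mathbb N$, $\mathcal N=\{1,\dots,n\}$, and for $i,j\in\mathcal N$ let $a_{ij}:[0,\infty)\to[0,\infty)$ be measurable and integrable on bounded intervals. A trajectory is a function $x:[0,\infty)\to\mathbb R^n$ satisfying, for all $t\ge 0$ and $i\in\mathcal N$, $$x_i(t)=x_i(0)+\int_0^t\sum_{j=1}^n a_{ij}(s)\,(x_j(s)-x_i(s))\,ds ,$$ where the integrand is integrable on $[0,t]$ (that is, $x$ is a Carathéodory solution of $\dot x_i=\sum_j a_{ij}(t)(x_j-x_i)$). Suppose that there are a nondecreasing sequence $(t_p)_{p\in\mathbb N}$ in $[0,\infty)$ with $\lim_{p\to\infty}t_p=+\infty$ and constants $K\ge 1$ and $M$ such that, for all $p\in\mathbb N$: (1) for every non-empty proper subset $S$ of $\mathcal N$, $$\sum_{i\in S,\,j\notin S}\int_{t_p}^{t_{p+1}}a_{ij}(t)\,dt\;\le\;K\sum_{i\in S,\,j\notin S}\int_{t_p}^{t_{p+1}}a_{ji}(t)\,dt ;$$ (2) $\int_{t_p}^{t_{p+1}}a_{ij}(t)\,dt\le M$ for all $i,j\in\mathcal N$. Then every trajectory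 $x$ converges in $\mathbb R^n$ as $t\to\infty$. Moreover, let $G$ be the directed graph on $\mathcal N$ with an edge from $j$ to $i$ exactly when $\int_0^\infty a_{ij}(t)\,dt=+\infty$. Then, for all $i,j\in\mathcal N$, there is a directed path from $i$ to $j$ in $G$ if and only if there is a directed path from $j$ to $i$ in $G$, and in that case $\lim_{t\to\infty}x_i(t)=\lim_{t\to\infty}x_j(t)$ for every trajectory $x$. -/

import Mathlib

open MeasureTheory Filter Topology

/-- Interaction weights `a i j : [0, ∞) → [0, ∞)` (only times `t ≥ 0` matter): non-negative,
Lebesgue measurable, and integrable on bounded intervals. -/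
structure IsInteractionWeights {n : ℕ} (a : Fin n → Fin n → ℝ → ℝ) : Prop where
  nonneg : ∀ i j t, 0 ≤ t → 0 ≤ a i j t
  measurable : ∀ i j, AEMeasurable (a i j) (volume.restrict (Set.Ici 0))
  integrableOn : ∀ i j T, 0 ≤ T → IntegrableOn (a i j) (Set.Icc 0 T)

/-- `x` is a trajectory of the consensus system with weights `a`: on `[0, ∞)` it satisfies
`x_i(t) = x_i(0) + ∫_0^t ∑_j a_ij(s) (x_j(s) - x_i(s)) ds`, the integrand being integrable on
each `[0, t]` (so that the integral is meaningful and `x` is locally absolutely continuous). -/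
def IsTrajectory {n : ℕ} (a : Fin n → Fin n → ℝ → ℝ) (x : ℝ → Fin n → ℝ) : Prop :=
  ∀ i t, 0 ≤ t →
    IntervalIntegrable (fun s => ∑ j, a i j s * (x s j - x s i)) volume 0 t ∧
    x t i = x 0 i + ∫ s in (0 : ℝ)..t, ∑ j, a i j s * (x s j - x s i)

/-- Integral weight reciprocity (cut-balance of the integral weights) along the increasing
sequence of times `t`, with ratio `K`. -/
structure IntegralReciprocity {n : ℕ} (a : Fin n → Fin n → ℝ → ℝ) (t : ℕ → ℝ) (K : ℝ) :
    Prop where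
  time_nonneg : ∀ p, 0 ≤ t p
  time_mono : Monotone t
  time_tendsto : Tendsto t atTop atTop
  one_le : 1 ≤ K
  cut_balance : ∀ S : Finset (Fin n), S.Nonempty → S ≠ Finset.univ → ∀ p : ℕ,
    ∑ i ∈ S, ∑ j ∈ Sᶜ, ∫ s in (t p)..(t (p + 1)), a i j s
      ≤ K * ∑ i ∈ S, ∑ j ∈ Sᶜ, ∫ s in (t p)..(t (p + 1)), a j i s

/-- The integral weights over the intervals `[t p, t (p + 1)]` are all bounded by `M`. -/
def IntegralWeightsBounded {n : ℕ} (a : Fin n → Fin n → ℝ → ℝ) (t : ℕ → ℝ) (M : ℝ) : Prop :=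
  ∀ i j p, ∫ s in (t p)..(t (p + 1)), a i j s ≤ M

/-- The directed graph of persistent weights: there is an edge from `j` to `i` when
`∫_0^∞ a_ij(s) ds = +∞`. -/
def persistentGraph {n : ℕ} (a : Fin n → Fin n → ℝ → ℝ) : Digraph (Fin n) where
  Adj j i := ∫⁻ s in Set.Ici (0 : ℝ), ENNReal.ofReal (a i j s) = ⊤

/-- There is a directed path from `i` to `j` in the digraph `G`. -/
def HasDirectedPath {V : Type*} (G : Digraph V) (i j : V) : Prop :=
  Relation.ReflTransGen G.Adj i j

/-! The Lyapunov function is the sum of the sorted states with weights `1, ρ, ρ ^ 2, …`, the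
smallest state being the heaviest. Across a cut between low and high states, low states are pulled
up and high states are pulled down. Integral reciprocity bounds the second flow by `K` times the
first, and for small `ρ` the weights make the first one win. The weights `a i j` may nevertheless be
unbalanced inside an interval, so the sum is compared only at the times `t p`.

The step from `t p` to `t (p + 1)` uses linearity. The state at `t p` is a constant plus a
nonnegative combination of indicators of upper level sets. Each indicator evolves above an explicit
subsolution, `cutBarrier`, and by comparison (`sum_cutBarrier_le`) the trajectory dominates their
superposition. Inserting this bound into the weighted sum (`gapFlow_add_rankWeightedSum_le`) gives
an increase of at least a fixed multiple of `gapFlow`. As trajectories are bounded, `gapFlow` is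
summable over `p`.

Up to constants, the `gapFlow` of `x` and of `-x` control the oscillation of `x` on each interval,
whence convergence. They also control the integral weights times `|x_i - x_j|`, whence equal limits
along edges whose weight has infinite integral. Reversibility of paths is independent of the
dynamics: it is reciprocity applied to the set of vertices reachable from `j`. -/

/-! ### Calculus of absolutely continuous functions -/

theorem LipschitzOnWith.comp_absolutelyContinuousOnInterval {g f : ℝ → ℝ} {C : NNReal}
    {u : Set ℝ} {s T : ℝ} (hg : LipschitzOnWith C g u) (hf : AbsolutelyContinuousOnInterval f s T)
    (hu : Set.MapsTo f (Set.uIcc s T) u) :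
    AbsolutelyContinuousOnInterval (fun t => g (f t)) s T := by
  unfold AbsolutelyContinuousOnInterval at hf ⊢
  refine squeeze_zero' (Eventually.of_forall fun E => Finset.sum_nonneg fun i _ => dist_nonneg)
    (?_ : ∀ᶠ E in _, _ ≤ (C : ℝ) * ∑ i ∈ Finset.range E.1, dist (f (E.2 i).1) (f (E.2 i).2))
    (by simpa using hf.const_mul (C : ℝ))
  refine eventually_inf_principal.2 (Eventually.of_forall fun E hE => ?_)
  rw [Finset.mul_sum]
  refine Finset.sum_le_sum fun i hi => ?_
  exact hg.dist_le_mul _ (hu (hE.1 i hi).1) _ (hu (hE.1 i hi).2)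

theorem AbsolutelyContinuousOnInterval.congr' {f g : ℝ → ℝ} {s T : ℝ}
    (hf : AbsolutelyContinuousOnInterval f s T) (hfg : Set.EqOn g f (Set.uIcc s T)) :
    AbsolutelyContinuousOnInterval g s T := by
  unfold AbsolutelyContinuousOnInterval at hf ⊢
  refine hf.congr' (eventually_inf_principal.2 (Eventually.of_forall fun E hE => ?_))
  refine Finset.sum_congr rfl fun i hi => ?_
  rw [hfg (hE.1 i hi).1, hfg (hE.1 i hi).2]

/-- `f` is absolutely continuous on `[s, T]` and has derivative `f'` almost everywhere. -/
structure HasAEDerivOn (f f' : ℝ → ℝ) (s T : ℝ) : Prop where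
  ac : AbsolutelyContinuousOnInterval f s T
  deriv : ∀ᵐ t, t ∈ Set.Ioo s T → HasDerivAt f (f' t) t

namespace HasAEDerivOn

variable {f f' g g' : ℝ → ℝ} {s T : ℝ}

theorem const (c : ℝ) : HasAEDerivOn (fun _ => c) (fun _ => 0) s T :=
  ⟨contDiffOn_const.absolutelyContinuousOnInterval,
    Eventually.of_forall fun t _ => hasDerivAt_const t c⟩

theorem add (hf : HasAEDerivOn f f' s T) (hg : HasAEDerivOn g g' s T) :
    HasAEDerivOn (fun t => f t + g t) (fun t => f' t + g' t) s T := by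
  refine ⟨hf.ac.add hg.ac, ?_⟩
  filter_upwards [hf.deriv, hg.deriv] with t h1 h2 ht
  exact (h1 ht).add (h2 ht)

theorem const_mul (c : ℝ) (hf : HasAEDerivOn f f' s T) :
    HasAEDerivOn (fun t => c * f t) (fun t => c * f' t) s T := by
  refine ⟨hf.ac.const_mul c, ?_⟩
  filter_upwards [hf.deriv] with t h1 ht
  exact (h1 ht).const_mul c

theorem sub (hf : HasAEDerivOn f f' s T) (hg : HasAEDerivOn g g' s T) :
    HasAEDerivOn (fun t => f t - g t) (fun t => f' t - g' t) s T := by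
  refine ⟨hf.ac.sub hg.ac, ?_⟩
  filter_upwards [hf.deriv, hg.deriv] with t h1 h2 ht
  exact (h1 ht).sub (h2 ht)

theorem sum {ι : Type*} {F F' : ι → ℝ → ℝ} (J : Finset ι)
    (h : ∀ i ∈ J, HasAEDerivOn (F i) (F' i) s T) :
    HasAEDerivOn (fun t => ∑ i ∈ J, F i t) (fun t => ∑ i ∈ J, F' i t) s T := by
  classical
  induction J using Finset.induction_on with
  | empty => simpa using const 0
  | insert i J hi ih =>
    simp only [Finset.sum_insert hi]
    exact (h i (by simp)).add (ih fun j hj => h j (by simp [hj]))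

theorem mul (hf : HasAEDerivOn f f' s T) (hg : HasAEDerivOn g g' s T) :
    HasAEDerivOn (fun t => f t * g t) (fun t => f' t * g t + f t * g' t) s T := by
  refine ⟨hf.ac.mul hg.ac, ?_⟩
  filter_upwards [hf.deriv, hg.deriv] with t h1 h2 ht
  exact (h1 ht).mul (h2 ht)

theorem exp (hf : HasAEDerivOn f f' s T) :
    HasAEDerivOn (fun t => Real.exp (f t)) (fun t => Real.exp (f t) * f' t) s T := by
  constructor
  -- `Real.exp` is only locally Lipschitz, which suffices because `f` is bounded on the interval.
  · obtain ⟨C, hC⟩ := hf.ac.exists_bound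
    obtain ⟨L, hL⟩ := (Real.contDiff_exp.contDiffOn (s := Set.Icc (-C) C)).exists_lipschitzOnWith
      one_ne_zero (convex_Icc _ _) isCompact_Icc
    exact hL.comp_absolutelyContinuousOnInterval hf.ac fun t ht => abs_le.1 (hC t ht)
  · filter_upwards [hf.deriv] with t h1 ht
    exact (h1 ht).exp

theorem integral (hf : IntervalIntegrable f volume s T) (hsT : s ≤ T) :
    HasAEDerivOn (fun t => ∫ u in s..t, f u) f s T := by
  refine ⟨hf.absolutelyContinuousOnInterval_intervalIntegral Set.left_mem_uIcc, ?_⟩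
  filter_upwards [hf.ae_hasDerivAt_integral] with t h1 ht
  exact h1 (by rw [Set.uIcc_of_le hsT]; exact Set.Ioo_subset_Icc_self ht) s Set.left_mem_uIcc

theorem congr (hf : HasAEDerivOn f f' s T) (hsT : s ≤ T) (h : Set.EqOn g f (Set.Icc s T)) :
    HasAEDerivOn g f' s T := by
  refine ⟨hf.ac.congr' (by rwa [Set.uIcc_of_le hsT]), ?_⟩
  filter_upwards [hf.deriv] with t h1 ht
  exact (h1 ht).congr_of_eventuallyEq
    (h.eventuallyEq_of_mem (mem_of_superset (Ioo_mem_nhds ht.1 ht.2) Set.Ioo_subset_Icc_self))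

theorem mono {s' T' : ℝ} (hf : HasAEDerivOn f f' s T) (hs : s ≤ s') (hsT : s' ≤ T')
    (hT : T' ≤ T) : HasAEDerivOn f f' s' T' := by
  refine ⟨hf.ac.mono ?_, ?_⟩
  · rw [Set.uIcc_of_le hsT, Set.uIcc_of_le (hs.trans (hsT.trans hT))]
    exact Set.Icc_subset_Icc hs hT
  · filter_upwards [hf.deriv] with t h1 ht
    exact h1 (Set.Ioo_subset_Ioo hs hT ht)

theorem continuousOn (hf : HasAEDerivOn f f' s T) (hsT : s ≤ T) :
    ContinuousOn f (Set.Icc s T) := by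
  simpa [Set.uIcc_of_le hsT] using hf.ac.continuousOn

theorem le_of_deriv_nonneg (hf : HasAEDerivOn f f' s T) (hsT : s ≤ T)
    (h : ∀ᵐ t, t ∈ Set.Ioo s T → 0 ≤ f' t) : f s ≤ f T := by
  rw [← sub_nonneg, ← hf.ac.integral_deriv_eq_sub]
  refine intervalIntegral.integral_nonneg_of_ae_restrict hsT ?_
  rw [← restrict_Ioo_eq_restrict_Icc]
  refine (ae_restrict_iff' measurableSet_Ioo).2 ?_
  filter_upwards [hf.deriv, h] with t h1 h2 ht
  rw [(h1 ht).deriv]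
  exact h2 ht

end HasAEDerivOn

/-! ### Comparison and barriers for a single cut -/

/-- Comparison principle: supersolutions of the consensus dynamics stay nonnegative. -/
theorem consensus_supersolution_nonneg {ι : Type*} [Fintype ι] {a : ι → ι → ℝ → ℝ} {s T : ℝ}
    (hsT : s ≤ T) (ha : ∀ i j t, t ∈ Set.Icc s T → 0 ≤ a i j t)
    (hint : ∀ i j, IntervalIntegrable (a i j) volume s T) {y y' : ι → ℝ → ℝ}
    (hy : ∀ i, HasAEDerivOn (y i) (y' i) s T)
    (hsup : ∀ i, ∀ᵐ t, t ∈ Set.Ioo s T → ∑ j, a i j t * (y j t - y i t) ≤ y' i t)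
    (h0 : ∀ i, 0 ≤ y i s) {t : ℝ} (ht : t ∈ Set.Icc s T) (i : ι) : 0 ≤ y i t := by
  refine le_of_forall_pos_le_add fun ε hε => ?_
  by_contra! hneg
  -- The infimum of `C` is the first time at which some component reaches `-ε`.
  set C : Set ℝ := ⋃ i, {u ∈ Set.Icc s T | y i u + ε ≤ 0} with hC
  have hCclosed : IsClosed C := by
    refine isClosed_iUnion_of_finite fun i => ?_
    exact (((hy i).continuousOn hsT).add continuousOn_const).preimage_isClosed_of_isClosed
      isClosed_Icc isClosed_Iic
  have hCne : C.Nonempty := ⟨t, Set.mem_iUnion.2 ⟨i, ht, hneg.le⟩⟩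
  have hCbdd : BddBelow C := ⟨s, fun u hu => by
    obtain ⟨k, hk⟩ := Set.mem_iUnion.1 hu
    exact hk.1.1⟩
  have hmem := hCclosed.csInf_mem hCne hCbdd
  set r := sInf C with hr
  obtain ⟨k, ⟨hsr, hrT⟩, hk⟩ := Set.mem_iUnion.1 hmem
  have hpos : ∀ u ∈ Set.Ico s r, ∀ j, 0 < y j u + ε := fun u hu j => by
    by_contra! hle
    exact absurd (csInf_le hCbdd (Set.mem_iUnion.2 ⟨j, ⟨hu.1, hu.2.le.trans hrT⟩, hle⟩))
      (not_le.2 hu.2)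
  have hαint : IntervalIntegrable (fun u => ∑ j, a k j u) volume s T := by
    simpa only [Finset.sum_fn] using
      IntervalIntegrable.sum Finset.univ (f := fun j => a k j) (fun j _ => hint k j)
  have hα := HasAEDerivOn.integral hαint hsT
  -- With the integrated row sum as integrating factor, this product is nondecreasing up to `r`,
  -- since all `y j + ε` are positive before `r`. It starts at `ε` or more, so it cannot be
  -- nonpositive at `r`.
  have hprod := ((hα.exp.mul ((hy k).add (HasAEDerivOn.const ε))).mono le_rfl hsr hrT)
  have hle := hprod.le_of_deriv_nonneg hsr ?_
  · simp only [intervalIntegral.integral_same, Real.exp_zero, one_mul] at hle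
    have h1 : Real.exp (∫ u in s..r, ∑ j, a k j u) * (y k r + ε) ≤ 0 :=
      mul_nonpos_of_nonneg_of_nonpos (Real.exp_pos _).le hk
    linarith [h0 k]
  · filter_upwards [hsup k] with u hu hur
    have huT : u ∈ Set.Ioo s T := ⟨hur.1, hur.2.trans_le hrT⟩
    have h1 := hu huT
    have h2 : 0 ≤ ∑ j, a k j u * (y j u + ε) := Finset.sum_nonneg fun j _ =>
      mul_nonneg (ha k j u (Set.Ioo_subset_Icc_self huT)) (hpos u ⟨hur.1.le, hur.2⟩ j).le
    have h3 : ∑ j, a k j u * (y j u - y k u)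
        = ∑ j, a k j u * (y j u + ε) - (∑ j, a k j u) * (y k u + ε) := by
      rw [Finset.sum_mul, ← Finset.sum_sub_distrib]
      exact Finset.sum_congr rfl fun j _ => by ring
    have h4 : 0 ≤ Real.exp (∫ v in s..u, ∑ j, a k j v) *
        ((∑ j, a k j u) * (y k u + ε) + y' k u) :=
      mul_nonneg (Real.exp_pos _).le (by linarith)
    linarith

section CutBarrier

variable {ι : Type*} {a : ι → ι → ℝ → ℝ} {s T : ℝ}

/-- The integral over `[s, t]` of the total weight going from `V` into `U`. -/
noncomputable def cutIntegral (a : ι → ι → ℝ → ℝ) (U V : Finset ι) (s t : ℝ) : ℝ :=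
  ∑ i ∈ U, ∑ j ∈ V, ∫ u in s..t, a i j u

theorem hasAEDerivOn_cutIntegral (hsT : s ≤ T)
    (hint : ∀ i j, IntervalIntegrable (a i j) volume s T) (U V : Finset ι) :
    HasAEDerivOn (cutIntegral a U V s) (fun t => ∑ i ∈ U, ∑ j ∈ V, a i j t) s T :=
  HasAEDerivOn.sum U fun i _ => HasAEDerivOn.sum V fun j _ =>
    HasAEDerivOn.integral (hint i j) hsT

theorem cutIntegral_nonneg (hw : ∀ i j u, u ∈ Set.Icc s T → 0 ≤ a i j u) (U V : Finset ι)
    {t : ℝ} (ht : t ∈ Set.Icc s T) : 0 ≤ cutIntegral a U V s t :=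
  Finset.sum_nonneg fun i _ => Finset.sum_nonneg fun j _ =>
    intervalIntegral.integral_nonneg ht.1 fun u hu => hw i j u ⟨hu.1, hu.2.trans ht.2⟩

theorem Finset.sum_sum_le_sum_sum_of_subset {κ : Type*} {U U' : Finset κ} {V V' : Finset κ}
    (hU : U ⊆ U') (hV : V ⊆ V') {A : κ → κ → ℝ} (hA : ∀ i j, 0 ≤ A i j) :
    ∑ i ∈ U, ∑ j ∈ V, A i j ≤ ∑ i ∈ U', ∑ j ∈ V', A i j :=
  (Finset.sum_le_sum fun i _ => Finset.sum_le_sum_of_subset_of_nonneg hV fun j _ _ => hA i j).trans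
    (Finset.sum_le_sum_of_subset_of_nonneg hU fun i _ _ => Finset.sum_nonneg fun j _ => hA i j)

theorem cutIntegral_mono_set (hw : ∀ i j u, u ∈ Set.Icc s T → 0 ≤ a i j u)
    {U U' V V' : Finset ι} (hU : U ⊆ U') (hV : V ⊆ V')
    {t : ℝ} (ht : t ∈ Set.Icc s T) : cutIntegral a U V s t ≤ cutIntegral a U' V' s t :=
  Finset.sum_sum_le_sum_sum_of_subset hU hV fun i j =>
    intervalIntegral.integral_nonneg ht.1 fun u hu => hw i j u ⟨hu.1, hu.2.trans ht.2⟩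

theorem cutIntegral_mono_time (hw : ∀ i j u, u ∈ Set.Icc s T → 0 ≤ a i j u)
    (hint : ∀ i j, IntervalIntegrable (a i j) volume s T) (U V : Finset ι)
    {t : ℝ} (ht : t ∈ Set.Icc s T) : cutIntegral a U V s t ≤ cutIntegral a U V s T := by
  refine Finset.sum_le_sum fun i _ => Finset.sum_le_sum fun j _ => ?_
  refine intervalIntegral.integral_mono_interval le_rfl ht.1 ht.2 ?_ (hint i j)
  refine (ae_restrict_iff' measurableSet_Ioc).2 (Eventually.of_forall fun u hu => ?_)
  exact hw i j u ⟨hu.1.le, hu.2⟩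

variable [Fintype ι] [DecidableEq ι]

/-- A subsolution of the consensus dynamics which starts at the indicator function of `Sᶜ`. -/
noncomputable def cutBarrier (a : ι → ι → ℝ → ℝ) (S : Finset ι) (s : ℝ) (i : ι) (t : ℝ) : ℝ :=
  if i ∈ S then
    Real.exp (-2 * cutIntegral a Finset.univ Finset.univ s t) * cutIntegral a {i} Sᶜ s t
  else Real.exp (-1 * cutIntegral a Sᶜ S s t)

/-- The derivative in time of `cutBarrier`. -/
noncomputable def cutBarrierDeriv (a : ι → ι → ℝ → ℝ) (S : Finset ι) (s : ℝ) (i : ι) (t : ℝ) : ℝ :=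
  if i ∈ S then
    Real.exp (-2 * cutIntegral a Finset.univ Finset.univ s t) * (-2 * ∑ i, ∑ j, a i j t) *
        cutIntegral a {i} Sᶜ s t
      + Real.exp (-2 * cutIntegral a Finset.univ Finset.univ s t) * ∑ i ∈ {i}, ∑ j ∈ Sᶜ, a i j t
  else Real.exp (-1 * cutIntegral a Sᶜ S s t) * (-1 * ∑ i ∈ Sᶜ, ∑ j ∈ S, a i j t)

theorem hasAEDerivOn_cutBarrier (hsT : s ≤ T)
    (hint : ∀ i j, IntervalIntegrable (a i j) volume s T) (S : Finset ι) (i : ι) :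
    HasAEDerivOn (cutBarrier a S s i) (cutBarrierDeriv a S s i) s T := by
  have hcut := hasAEDerivOn_cutIntegral hsT hint
  by_cases hi : i ∈ S
  · have h := (((hcut Finset.univ Finset.univ).const_mul (-2)).exp).mul (hcut {i} Sᶜ)
    convert h using 1
    · ext t; simp only [cutBarrier, if_pos hi]
    · ext t; simp only [cutBarrierDeriv, if_pos hi]
  · have h := ((hcut Sᶜ S).const_mul (-1)).exp
    convert h using 1
    · ext t; simp only [cutBarrier, if_neg hi]
    · ext t; simp only [cutBarrierDeriv, if_neg hi]

theorem cutBarrier_nonneg (hw : ∀ i j u, u ∈ Set.Icc s T → 0 ≤ a i j u) (S : Finset ι) (i : ι)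
    {t : ℝ} (ht : t ∈ Set.Icc s T) : 0 ≤ cutBarrier a S s i t := by
  unfold cutBarrier
  split_ifs
  · exact mul_nonneg (Real.exp_pos _).le (cutIntegral_nonneg hw _ _ ht)
  · exact (Real.exp_pos _).le

/-- Outside `S` all barriers are equal, so only the weights coming from `S` pull them down, and the
exponential decays at least that fast. Inside `S`, the total weight dominates both the row sum,
which drains the barrier, and the cut weight, which makes `Sᶜ` decay; the prefactor absorbs both
effects. -/
theorem cutBarrierDeriv_le (hw : ∀ i j u, u ∈ Set.Icc s T → 0 ≤ a i j u) (S : Finset ι) (i : ι)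
    {t : ℝ} (ht : t ∈ Set.Icc s T) :
    cutBarrierDeriv a S s i t
      ≤ ∑ j, a i j t * (cutBarrier a S s j t - cutBarrier a S s i t) := by
  have hwt : ∀ i j, 0 ≤ a i j t := fun i j => hw i j t ht
  have hb0 := fun j => cutBarrier_nonneg hw S j ht
  have hsplit : ∑ j, a i j t * (cutBarrier a S s j t - cutBarrier a S s i t)
      = ∑ j ∈ S, a i j t * cutBarrier a S s j t + ∑ j ∈ Sᶜ, a i j t * cutBarrier a S s j t
        - (∑ j ∈ S, a i j t + ∑ j ∈ Sᶜ, a i j t) * cutBarrier a S s i t := by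
    rw [Finset.sum_add_sum_compl, Finset.sum_add_sum_compl, Finset.sum_mul,
      ← Finset.sum_sub_distrib]
    exact Finset.sum_congr rfl fun j _ => by ring
  have hS0 : 0 ≤ ∑ j ∈ S, a i j t * cutBarrier a S s j t :=
    Finset.sum_nonneg fun j _ => mul_nonneg (hwt i j) (hb0 j)
  have hcompl : ∑ j ∈ Sᶜ, a i j t * cutBarrier a S s j t
      = (∑ j ∈ Sᶜ, a i j t) * Real.exp (-1 * cutIntegral a Sᶜ S s t) := by
    rw [Finset.sum_mul]
    refine Finset.sum_congr rfl fun j hj => ?_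
    rw [cutBarrier, if_neg (by simpa using hj)]
  rw [hsplit, hcompl]
  have hrowS : 0 ≤ ∑ j ∈ S, a i j t := Finset.sum_nonneg fun j _ => hwt i j
  have hrowSc : 0 ≤ ∑ j ∈ Sᶜ, a i j t := Finset.sum_nonneg fun j _ => hwt i j
  by_cases hi : i ∈ S
  · have hb := hb0 i
    simp only [cutBarrier, if_pos hi] at hb
    simp only [cutBarrier, if_pos hi, cutBarrierDeriv, Finset.sum_singleton]
    simp only [cutBarrier] at hS0
    set H := cutIntegral a Finset.univ Finset.univ s t
    set E := Real.exp (-2 * H)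
    have hexp : E ≤ Real.exp (-1 * cutIntegral a Sᶜ S s t) := by
      refine Real.exp_le_exp.2 ?_
      have h1 : cutIntegral a Sᶜ S s t ≤ H :=
        cutIntegral_mono_set hw (Finset.subset_univ _) (Finset.subset_univ _) ht
      have h2 : 0 ≤ cutIntegral a Sᶜ S s t := cutIntegral_nonneg hw _ _ ht
      linarith
    have hrow : ∑ j ∈ S, a i j t + ∑ j ∈ Sᶜ, a i j t ≤ 2 * ∑ i, ∑ j, a i j t := by
      rw [Finset.sum_add_sum_compl]
      have h1 : ∑ j, a i j t ≤ ∑ i, ∑ j, a i j t :=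
        Finset.single_le_sum (f := fun i => ∑ j, a i j t)
          (fun i _ => Finset.sum_nonneg fun j _ => hwt i j) (Finset.mem_univ i)
      have h2 : 0 ≤ ∑ j, a i j t := Finset.sum_nonneg fun j _ => hwt i j
      linarith
    have h3 := mul_le_mul_of_nonneg_right hrow hb
    have h4 := mul_le_mul_of_nonneg_left hexp hrowSc
    linarith
  · simp only [cutBarrier, if_neg hi, cutBarrierDeriv]
    simp only [cutBarrier] at hS0
    have hrow : ∑ j ∈ S, a i j t ≤ ∑ i ∈ Sᶜ, ∑ j ∈ S, a i j t :=
      Finset.single_le_sum (f := fun i => ∑ j ∈ S, a i j t)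
        (fun i _ => Finset.sum_nonneg fun j _ => hwt i j) (Finset.mem_compl.2 hi)
    have h3 := mul_le_mul_of_nonneg_right hrow
      (Real.exp_pos (-1 * cutIntegral a Sᶜ S s t)).le
    linarith

theorem cutBarrier_self (S : Finset ι) (i : ι) :
    cutBarrier a S s i s = if i ∈ S then 0 else 1 := by
  simp [cutBarrier, cutIntegral]

theorem le_cutBarrier_of_mem (hw : ∀ i j u, u ∈ Set.Icc s T → 0 ≤ a i j u) {L : ℝ}
    {S : Finset ι} {i : ι} (hi : i ∈ S) {t : ℝ} (ht : t ∈ Set.Icc s T)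
    (hL : cutIntegral a Finset.univ Finset.univ s t ≤ L) :
    Real.exp (-2 * L) * ∑ j ∈ Sᶜ, ∫ u in s..t, a i j u ≤ cutBarrier a S s i t := by
  have h := cutIntegral_nonneg hw {i} Sᶜ ht
  simp only [cutBarrier, if_pos hi]
  simp only [cutIntegral, Finset.sum_singleton] at h hL ⊢
  exact mul_le_mul_of_nonneg_right (Real.exp_le_exp.2 (by linarith)) h

theorem le_cutBarrier_of_notMem (hw : ∀ i j u, u ∈ Set.Icc s T → 0 ≤ a i j u) {L : ℝ}
    {S : Finset ι} {i : ι} (hi : i ∉ S) {t : ℝ} (ht : t ∈ Set.Icc s T)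
    (hL : cutIntegral a Finset.univ Finset.univ s t ≤ L) :
    Real.exp (-2 * L) ≤ cutBarrier a S s i t := by
  have h := cutIntegral_nonneg hw Sᶜ S ht
  have h' := cutIntegral_mono_set hw (Finset.subset_univ Sᶜ) (Finset.subset_univ S) ht
  simp only [cutBarrier, if_neg hi]
  exact Real.exp_le_exp.2 (by linarith)

theorem one_sub_cutIntegral_le_cutBarrier (hw : ∀ i j u, u ∈ Set.Icc s T → 0 ≤ a i j u)
    (hint : ∀ i j, IntervalIntegrable (a i j) volume s T)
    {S : Finset ι} {i : ι} (hi : i ∉ S) {t : ℝ} (ht : t ∈ Set.Icc s T) :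
    1 - cutIntegral a Sᶜ S s T ≤ cutBarrier a S s i t := by
  have h := cutIntegral_mono_time hw hint Sᶜ S ht
  simp only [cutBarrier, if_neg hi]
  linarith [Real.add_one_le_exp (-1 * cutIntegral a Sᶜ S s t)]

/-- A solution dominates the superposition of the barriers of the cuts decomposing its initial
value. -/
theorem sum_cutBarrier_le (hsT : s ≤ T) (hw : ∀ i j u, u ∈ Set.Icc s T → 0 ≤ a i j u)
    (hint : ∀ i j, IntervalIntegrable (a i j) volume s T) {x : ℝ → ι → ℝ}
    (hx : ∀ i, HasAEDerivOn (fun t => x t i) (fun t => ∑ j, a i j t * (x t j - x t i)) s T)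
    {κ : Type*} (J : Finset κ) (m : ℝ) {g : κ → ℝ} (hg : ∀ k, 0 ≤ g k) (S : κ → Finset ι)
    (h0 : ∀ i, x s i = m + ∑ k ∈ J, g k * if i ∈ S k then 0 else 1)
    {t : ℝ} (ht : t ∈ Set.Icc s T) (i : ι) :
    m + ∑ k ∈ J, g k * cutBarrier a (S k) s i t ≤ x t i := by
  have hbar : ∀ i, HasAEDerivOn (fun t => m + ∑ k ∈ J, g k * cutBarrier a (S k) s i t)
      (fun t => 0 + ∑ k ∈ J, g k * cutBarrierDeriv a (S k) s i t) s T := fun i =>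
    (HasAEDerivOn.const m).add (HasAEDerivOn.sum J fun k _ =>
      (hasAEDerivOn_cutBarrier hsT hint (S k) i).const_mul (g k))
  rw [← sub_nonneg]
  -- The dynamics are linear, so the solution minus the superposed subsolutions is a supersolution
  -- starting at `0`.
  refine consensus_supersolution_nonneg hsT hw hint (fun i => (hx i).sub (hbar i)) (fun i => ?_)
    (fun i => ?_) ht i
  · refine Eventually.of_forall fun u hu => ?_
    have hk : ∑ k ∈ J, g k * cutBarrierDeriv a (S k) s i u
        ≤ ∑ k ∈ J, g k * ∑ j, a i j u * (cutBarrier a (S k) s j u - cutBarrier a (S k) s i u) :=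
      Finset.sum_le_sum fun k _ => mul_le_mul_of_nonneg_left
        (cutBarrierDeriv_le hw (S k) i (Set.Ioo_subset_Icc_self hu)) (hg k)
    have hswap : ∑ k ∈ J, g k * ∑ j, a i j u * (cutBarrier a (S k) s j u - cutBarrier a (S k) s i u)
        = ∑ j, a i j u * (∑ k ∈ J, g k * cutBarrier a (S k) s j u
          - ∑ k ∈ J, g k * cutBarrier a (S k) s i u) := by
      simp_rw [← Finset.sum_sub_distrib, Finset.mul_sum]
      rw [Finset.sum_comm]
      exact Finset.sum_congr rfl fun j _ => Finset.sum_congr rfl fun k _ => by ring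
    have hlin : ∑ j, a i j u * (x u j - (m + ∑ k ∈ J, g k * cutBarrier a (S k) s j u)
          - (x u i - (m + ∑ k ∈ J, g k * cutBarrier a (S k) s i u)))
        = ∑ j, a i j u * (x u j - x u i)
          - ∑ j, a i j u * (∑ k ∈ J, g k * cutBarrier a (S k) s j u
          - ∑ k ∈ J, g k * cutBarrier a (S k) s i u) := by
      rw [← Finset.sum_sub_distrib]
      exact Finset.sum_congr rfl fun j _ => by ring
    simp only [hlin]
    linarith
  · simp only [cutBarrier_self, h0 i, sub_self, le_refl]

end CutBarrier

/-! ### Rank weights across one cut -/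

/-- If no index drops across level `k`, the upper set of `f` lies in that of `e`; their
cardinalities agree, so they coincide. -/
theorem exists_rank_le_or_rank_le_iff {n : ℕ} (e f : Equiv.Perm (Fin n)) (k : ℕ) :
    (∃ i, k < (f i : ℕ) ∧ (e i : ℕ) ≤ k) ∨ ∀ i, (e i : ℕ) ≤ k ↔ (f i : ℕ) ≤ k := by
  by_cases h : ∃ i, k < (f i : ℕ) ∧ (e i : ℕ) ≤ k
  · exact Or.inl h
  right
  push Not at h
  set U : Finset (Fin n) := Finset.univ.filter fun r => k < (r : ℕ)
  have hsub : Finset.univ.filter (fun i => k < (f i : ℕ))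
      ⊆ Finset.univ.filter (fun i => k < (e i : ℕ)) := fun i hi => by
    simpa using h i (by simpa using hi)
  have hcard : ∀ g : Equiv.Perm (Fin n),
      (Finset.univ.filter (fun i => k < (g i : ℕ))).card = U.card := fun g => by
    refine Finset.card_bij (fun i _ => g i) (fun i hi => by simpa [U] using hi)
      (fun i _ j _ hij => g.injective hij) fun r hr => ⟨g.symm r, by simpa [U] using hr, by simp⟩
  have heq := Finset.eq_of_subset_of_card_le hsub ((hcard e).trans (hcard f).symm).le
  intro i
  have := Finset.ext_iff.1 heq i
  simp only [Finset.mem_filter, Finset.mem_univ, true_and] at this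
  rw [← not_lt, ← not_lt, this]

/-- The one-step increase of the rank-weighted sum, for the contribution of a single cut: `f` ranks
the states before the step, `e` after it, and `l` bounds from below the influence of the states
of rank above `k` on each state. -/
theorem cut_le_sum_rank_weight {n : ℕ} {A : Fin n → Fin n → ℝ} (hA : ∀ i j, 0 ≤ A i j)
    {K L ε ρ : ℝ} (hK : 0 ≤ K) (hε : 0 < ε) (hρ : 0 < ρ) (hρ1 : ρ ≤ 1)
    (hnρ : n * ρ ≤ ε / 2) (hnK : n * ρ * K ≤ ε / 2)
    (hL : ∑ i, ∑ j, A i j ≤ L) (e f : Equiv.Perm (Fin n)) {k : ℕ} (hk : k < n)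
    {S : Finset (Fin n)} (hS : ∀ i, i ∈ S ↔ (f i : ℕ) ≤ k)
    (hcut : ∑ i ∈ Sᶜ, ∑ j ∈ S, A i j ≤ K * ∑ i ∈ S, ∑ j ∈ Sᶜ, A i j)
    {l : Fin n → ℝ} (hl0 : ∀ i, 0 ≤ l i) (hl : ∀ i ∈ S, ε * ∑ j ∈ Sᶜ, A i j ≤ l i)
    (hl1 : ∀ i ∉ S, 1 - ∑ i ∈ Sᶜ, ∑ j ∈ S, A i j ≤ l i) (hl2 : ∀ i ∉ S, ε ≤ l i) :
    ρ ^ n * ε / (2 * (L + 1)) * ∑ i ∈ S, ∑ j ∈ Sᶜ, A i j + ∑ i ∈ Sᶜ, ρ ^ (f i : ℕ)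
      ≤ ∑ i, ρ ^ (e i : ℕ) * l i := by
  set D := ∑ i ∈ S, ∑ j ∈ Sᶜ, A i j with hD
  set B := ∑ i ∈ Sᶜ, ∑ j ∈ S, A i j with hB
  have hD0 : 0 ≤ D := Finset.sum_nonneg fun i _ => Finset.sum_nonneg fun j _ => hA i j
  have hDL : D ≤ L :=
    (Finset.sum_sum_le_sum_sum_of_subset (Finset.subset_univ _) (Finset.subset_univ _) hA).trans hL
  have hL1 : 0 < L + 1 := by linarith
  set W := ∑ i ∈ Sᶜ, ρ ^ (f i : ℕ) with hW
  have hW0 : 0 ≤ W := Finset.sum_nonneg fun i _ => by positivity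
  have hpk : 0 < ρ ^ k := pow_pos hρ k
  have hWle : W ≤ ρ ^ k * (n * ρ) := by
    have h1 : W ≤ ∑ i ∈ Sᶜ, ρ ^ (k + 1) := by
      refine Finset.sum_le_sum fun i hi => pow_le_pow_of_le_one hρ.le hρ1 ?_
      rw [Finset.mem_compl, hS] at hi
      omega
    have h2 : ∑ i ∈ Sᶜ, ρ ^ (k + 1) ≤ n * ρ ^ (k + 1) :=
      (Finset.sum_le_sum_of_subset_of_nonneg (Finset.subset_univ _)
        fun i _ _ => by positivity).trans_eq (by simp)
    calc W ≤ _ := h1.trans h2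
      _ = ρ ^ k * (n * ρ) := by ring
  have hpn : ρ ^ n ≤ ρ ^ k := pow_le_pow_of_le_one hρ.le hρ1 hk.le
  -- The denominator `L + 1` serves both cases below: it makes the gain at most `ε / 2`, because `D
  -- ≤ L`, and at most `ε / 2 * D`, because `L + 1 ≥ 1`.
  have hc0 : 0 ≤ ε / (2 * (L + 1)) := by positivity
  have hsplit := Finset.sum_add_sum_compl S fun i => ρ ^ (e i : ℕ) * l i
  have hterm : ∀ i, 0 ≤ ρ ^ (e i : ℕ) * l i := fun i => mul_nonneg (by positivity) (hl0 i)
  have hcD : ρ ^ n * ε / (2 * (L + 1)) * D ≤ ρ ^ k * (ε / (2 * (L + 1)) * D) := by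
    calc ρ ^ n * ε / (2 * (L + 1)) * D = ρ ^ n * (ε / (2 * (L + 1)) * D) := by ring
      _ ≤ _ := mul_le_mul_of_nonneg_right hpn (mul_nonneg hc0 hD0)
  rcases exists_rank_le_or_rank_le_iff e f k with ⟨i, hfi, hei⟩ | hiff
  -- An upper index has dropped to rank at most `k`: its term alone, at least `ρ ^ k * ε`, pays for
  -- both `W` and the gain.
  · have hiS : i ∉ S := by rw [hS]; omega
    have h1 : ρ ^ k * ε ≤ ρ ^ (e i : ℕ) * l i :=
      mul_le_mul (pow_le_pow_of_le_one hρ.le hρ1 hei) (hl2 i hiS) hε.le (by positivity)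
    have h2 : ρ ^ (e i : ℕ) * l i ≤ ∑ i, ρ ^ (e i : ℕ) * l i :=
      Finset.single_le_sum (fun i _ => hterm i) (Finset.mem_univ i)
    have h3 : ε / (2 * (L + 1)) * D ≤ ε / 2 := by
      rw [div_mul_eq_mul_div, div_le_iff₀ (by positivity)]
      nlinarith
    have h4 := mul_le_mul_of_nonneg_left h3 hpk.le
    have h5 := mul_le_mul_of_nonneg_left hnρ hpk.le
    linarith
  -- The upper set is unchanged: `S` gains at least `ρ ^ k * ε * D`, while `Sᶜ` loses at most `W *
  -- B`, which reciprocity and the choice of `ρ` bound by half of that.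
  · have hWe : W = ∑ i ∈ Sᶜ, ρ ^ (e i : ℕ) := by
      have hmem : ∀ g : Equiv.Perm (Fin n), (∀ i, i ∈ S ↔ (g i : ℕ) ≤ k) →
          ∑ i ∈ Sᶜ, ρ ^ (g i : ℕ)
            = ∑ r ∈ Finset.univ.filter (fun r : Fin n => k < (r : ℕ)), ρ ^ (r : ℕ) := by
        intro g hg
        refine Finset.sum_bij (fun i _ => g i) (fun i hi => ?_)
          (fun i _ j _ hij => g.injective hij) (fun r hr => ⟨g.symm r, ?_, by simp⟩)
          fun _ _ => rfl
        · rw [Finset.mem_compl, hg] at hi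
          simpa using hi
        · rw [Finset.mem_compl, hg]
          simpa using hr
      rw [hW, hmem f hS, hmem e fun i => (hS i).trans (hiff i).symm]
    have h1 : ρ ^ k * (ε * D) ≤ ∑ i ∈ S, ρ ^ (e i : ℕ) * l i := by
      rw [hD, Finset.mul_sum, Finset.mul_sum]
      refine Finset.sum_le_sum fun i hi => ?_
      have hei : (e i : ℕ) ≤ k := (hiff i).2 ((hS i).1 hi)
      exact mul_le_mul (pow_le_pow_of_le_one hρ.le hρ1 hei) (hl i hi)
        (mul_nonneg hε.le (Finset.sum_nonneg fun j _ => hA i j)) (by positivity)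
    have h2 : W * (1 - B) ≤ ∑ i ∈ Sᶜ, ρ ^ (e i : ℕ) * l i := by
      rw [hWe, Finset.sum_mul]
      exact Finset.sum_le_sum fun i hi =>
        mul_le_mul_of_nonneg_left (hl1 i (Finset.mem_compl.1 hi)) (by positivity)
    have h3 : W * B ≤ ρ ^ k * (ε / 2 * D) := by
      calc W * B ≤ W * (K * D) := mul_le_mul_of_nonneg_left hcut hW0
        _ ≤ ρ ^ k * (n * ρ) * (K * D) := mul_le_mul_of_nonneg_right hWle (mul_nonneg hK hD0)
        _ = ρ ^ k * (n * ρ * K * D) := by ring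
        _ ≤ _ := mul_le_mul_of_nonneg_left (mul_le_mul_of_nonneg_right hnK hD0) hpk.le
    have h4 : ε / (2 * (L + 1)) * D ≤ ε / 2 * D := by
      refine mul_le_mul_of_nonneg_right ?_ hD0
      exact div_le_div_of_nonneg_left hε.le two_pos (by linarith)
    have h5 := mul_le_mul_of_nonneg_left h4 hpk.le
    linarith

/-! ### Decomposition of a vector along its sorted values -/

section Ranking

variable {n : ℕ} (v : Fin n → ℝ)

/-- The rank of `i` in a sorting of the values of `v` in nondecreasing order. -/
noncomputable def valueRank : Equiv.Perm (Fin n) := (Tuple.sort v).symm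

/-- The difference of the values of rank `k + 1` and `k` of `v`. -/
noncomputable def sortedGap (k : ℕ) : ℝ :=
  if h : k + 1 < n then
    v (Tuple.sort v ⟨k + 1, h⟩) - v (Tuple.sort v ⟨k, (Nat.lt_succ_self k).trans h⟩)
  else 0

/-- The smallest value of `v`. -/
noncomputable def sortedBottom : ℝ := if h : 0 < n then v (Tuple.sort v ⟨0, h⟩) else 0

/-- The set of indices of the `k + 1` smallest values of `v`. -/
noncomputable def lowerCut (k : ℕ) : Finset (Fin n) :=
  Finset.univ.filter fun i => (valueRank v i : ℕ) ≤ k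

/-- The sum of the values of `v` in nondecreasing order, with weights `1, ρ, ρ ^ 2, …`. -/
noncomputable def rankWeightedSum (ρ : ℝ) : ℝ := ∑ i, ρ ^ (valueRank v i : ℕ) * v i

/-- The sum over the lower cuts of `v` of the weights entering the cut, times the gap of `v` at
the cut. -/
noncomputable def gapFlow (A : Fin n → Fin n → ℝ) : ℝ :=
  ∑ k ∈ Finset.range n, sortedGap v k * ∑ i ∈ lowerCut v k, ∑ j ∈ (lowerCut v k)ᶜ, A i j

variable {v}

theorem mem_lowerCut {k : ℕ} {i : Fin n} : i ∈ lowerCut v k ↔ (valueRank v i : ℕ) ≤ k := by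
  simp [lowerCut]

theorem sortedGap_nonneg (k : ℕ) : 0 ≤ sortedGap v k := by
  unfold sortedGap
  split_ifs with h
  · exact sub_nonneg.2 (Tuple.monotone_sort v (Fin.mk_le_mk.2 (Nat.le_succ k)))
  · exact le_rfl

theorem apply_sort_eq (r : ℕ) (hr : r < n) :
    v (Tuple.sort v ⟨r, hr⟩) = sortedBottom v + ∑ k ∈ Finset.range r, sortedGap v k := by
  induction r with
  | zero => simp [sortedBottom, hr]
  | succ r ih =>
    rw [Finset.sum_range_succ, ← add_assoc, ← ih ((Nat.lt_succ_self r).trans hr), sortedGap,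
      dif_pos hr]
    ring

/-- Telescoping along the ranks below that of `i`. The index `k = n - 1` contributes nothing, as its
cut contains every index. -/
theorem eq_sortedBottom_add_sum (v : Fin n → ℝ) (i : Fin n) :
    v i = sortedBottom v
      + ∑ k ∈ Finset.range n, sortedGap v k * if i ∈ lowerCut v k then 0 else 1 := by
  have h := apply_sort_eq (v := v) (valueRank v i) (valueRank v i).2
  simp only [valueRank, Fin.eta, Equiv.apply_symm_apply] at h
  rw [h]
  congr 1
  have hsub : Finset.range (valueRank v i : ℕ) ⊆ Finset.range n :=
    Finset.range_subset_range.2 (valueRank v i).2.le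
  refine Eq.trans ?_ (Finset.sum_subset hsub fun k _ hk => ?_)
  · refine Finset.sum_congr rfl fun k hk => ?_
    rw [if_neg (by rw [mem_lowerCut]; simpa using hk), mul_one]
  · rw [if_pos (by rw [mem_lowerCut]; simpa using hk), mul_zero]

theorem abs_rankWeightedSum_le {ρ R : ℝ} (hρ : 0 ≤ ρ) (hρ1 : ρ ≤ 1) (hv : ∀ i, |v i| ≤ R) :
    |rankWeightedSum v ρ| ≤ n * R := by
  refine (Finset.abs_sum_le_sum_abs _ _).trans ?_
  calc ∑ i, |ρ ^ (valueRank v i : ℕ) * v i| ≤ ∑ _i : Fin n, R := by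
        refine Finset.sum_le_sum fun i _ => ?_
        rw [abs_mul, abs_of_nonneg (pow_nonneg hρ _)]
        exact (mul_le_of_le_one_left (abs_nonneg _) (pow_le_one₀ hρ hρ1)).trans (hv i)
    _ = n * R := by simp

variable {A : Fin n → Fin n → ℝ}

theorem gapFlow_nonneg (hA : ∀ i j, 0 ≤ A i j) : 0 ≤ gapFlow v A :=
  Finset.sum_nonneg fun k _ => mul_nonneg (sortedGap_nonneg k)
    (Finset.sum_nonneg fun i _ => Finset.sum_nonneg fun j _ => hA i j)

/-- `|v i - v j|` is the sum of the gaps at the cuts separating `i` from `j`. At each of them `A i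
j` is part of the flow into the lower set, or of the opposite flow, which is at most `K` times as
large. -/
theorem mul_abs_sub_le_gapFlow (hA : ∀ i j, 0 ≤ A i j) {K : ℝ} (hK : 0 ≤ K)
    (hcut : ∀ S : Finset (Fin n),
      ∑ i ∈ Sᶜ, ∑ j ∈ S, A i j ≤ K * ∑ i ∈ S, ∑ j ∈ Sᶜ, A i j) (i j : Fin n) :
    A i j * |v i - v j| ≤ (1 + K) * gapFlow v A := by
  rw [eq_sortedBottom_add_sum v i, eq_sortedBottom_add_sum v j, add_sub_add_left_eq_sub,
    ← Finset.sum_sub_distrib, gapFlow, Finset.mul_sum]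
  refine (mul_le_mul_of_nonneg_left (Finset.abs_sum_le_sum_abs _ _) (hA i j)).trans ?_
  rw [Finset.mul_sum]
  refine Finset.sum_le_sum fun k _ => ?_
  set S := lowerCut v k
  have hg := sortedGap_nonneg (v := v) k
  have hD0 : 0 ≤ ∑ i ∈ S, ∑ j ∈ Sᶜ, A i j :=
    Finset.sum_nonneg fun i _ => Finset.sum_nonneg fun j _ => hA i j
  have hle : ∀ U V : Finset (Fin n), i ∈ U → j ∈ V → A i j ≤ ∑ i ∈ U, ∑ j ∈ V, A i j := by
    intro U V hi hj
    simpa using Finset.sum_sum_le_sum_sum_of_subset (Finset.singleton_subset_iff.2 hi)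
      (Finset.singleton_subset_iff.2 hj) hA
  have hKD := mul_nonneg hK hD0
  have hrhs : (1 + K) * (sortedGap v k * ∑ i ∈ S, ∑ j ∈ Sᶜ, A i j)
      = sortedGap v k * (∑ i ∈ S, ∑ j ∈ Sᶜ, A i j + K * ∑ i ∈ S, ∑ j ∈ Sᶜ, A i j) := by ring
  rw [hrhs]
  by_cases hi : i ∈ S <;> by_cases hj : j ∈ S <;> simp only [hi, hj, if_true, if_false]
  · simpa using mul_nonneg hg (add_nonneg hD0 hKD)
  · have h := hle S Sᶜ hi (Finset.mem_compl.2 hj)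
    simp only [mul_zero, mul_one, zero_sub, abs_neg, abs_of_nonneg hg]
    rw [mul_comm]
    exact mul_le_mul_of_nonneg_left (by linarith) hg
  · have h := (hle Sᶜ S (Finset.mem_compl.2 hi) hj).trans (hcut S)
    simp only [mul_zero, mul_one, sub_zero, abs_of_nonneg hg]
    rw [mul_comm]
    exact mul_le_mul_of_nonneg_left (by linarith) hg
  · simpa using mul_nonneg hg (add_nonneg hD0 hKD)

end Ranking

/-! ### Estimates over one time interval -/

section Step

variable {n : ℕ} {a : Fin n → Fin n → ℝ → ℝ} {s T K : ℝ} {x : ℝ → Fin n → ℝ}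

/-- Each barrier loses at most the weight from `S` into `Sᶜ`, hence at most `K` times the weight
counted in `gapFlow`. -/
theorem sub_gapFlow_le (hsT : s ≤ T) (hw : ∀ i j u, u ∈ Set.Icc s T → 0 ≤ a i j u)
    (hint : ∀ i j, IntervalIntegrable (a i j) volume s T)
    (hx : ∀ i, HasAEDerivOn (fun t => x t i) (fun t => ∑ j, a i j t * (x t j - x t i)) s T)
    (hK : 0 ≤ K) (hcut : ∀ S : Finset (Fin n),
      cutIntegral a Sᶜ S s T ≤ K * cutIntegral a S Sᶜ s T)
    {t : ℝ} (ht : t ∈ Set.Icc s T) (i : Fin n) :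
    x s i - K * gapFlow (x s) (fun i j => ∫ u in s..T, a i j u) ≤ x t i := by
  refine le_trans ?_ (sum_cutBarrier_le hsT hw hint hx (Finset.range n) (sortedBottom (x s))
    (fun k => sortedGap_nonneg k) (lowerCut (x s)) (eq_sortedBottom_add_sum (x s)) ht i)
  nth_rewrite 1 [eq_sortedBottom_add_sum (x s) i]
  rw [gapFlow, Finset.mul_sum, add_sub_assoc, ← Finset.sum_sub_distrib]
  refine add_le_add le_rfl (Finset.sum_le_sum fun k _ => ?_)
  set S := lowerCut (x s) k
  have hD : cutIntegral a S Sᶜ s T = ∑ i ∈ S, ∑ j ∈ Sᶜ, ∫ u in s..T, a i j u := rfl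
  rw [← hD]
  have hD0 : 0 ≤ cutIntegral a S Sᶜ s T := cutIntegral_nonneg hw S Sᶜ ⟨hsT, le_rfl⟩
  have h : (if i ∈ S then (0 : ℝ) else 1) - K * cutIntegral a S Sᶜ s T ≤ cutBarrier a S s i t := by
    split_ifs with hi
    · have := cutBarrier_nonneg hw S i ht
      have := mul_nonneg hK hD0
      linarith
    · have := one_sub_cutIntegral_le_cutBarrier hw hint hi ht
      have := hcut S
      linarith
  have := mul_le_mul_of_nonneg_left h (sortedGap_nonneg (v := x s) k)
  linarith

theorem gapFlow_add_rankWeightedSum_le (hsT : s ≤ T)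
    (hw : ∀ i j u, u ∈ Set.Icc s T → 0 ≤ a i j u)
    (hint : ∀ i j, IntervalIntegrable (a i j) volume s T)
    (hx : ∀ i, HasAEDerivOn (fun t => x t i) (fun t => ∑ j, a i j t * (x t j - x t i)) s T)
    (hK : 0 ≤ K) (hcut : ∀ S : Finset (Fin n),
      cutIntegral a Sᶜ S s T ≤ K * cutIntegral a S Sᶜ s T)
    {L ρ : ℝ} (hL : cutIntegral a Finset.univ Finset.univ s T ≤ L) (hρ : 0 < ρ) (hρ1 : ρ ≤ 1)
    (hnρ : n * ρ ≤ Real.exp (-2 * L) / 2) (hnK : n * ρ * K ≤ Real.exp (-2 * L) / 2) :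
    ρ ^ n * Real.exp (-2 * L) / (2 * (L + 1)) *
        gapFlow (x s) (fun i j => ∫ u in s..T, a i j u) + rankWeightedSum (x s) ρ
      ≤ rankWeightedSum (x T) ρ := by
  have hT : T ∈ Set.Icc s T := ⟨hsT, le_rfl⟩
  set c := ρ ^ n * Real.exp (-2 * L) / (2 * (L + 1)) with hc
  set m := sortedBottom (x s) with hm
  set g := sortedGap (x s) with hg
  set S := lowerCut (x s) with hS
  set f := valueRank (x s) with hf
  set e := valueRank (x T) with he
  have hlow := sum_cutBarrier_le hsT hw hint hx (Finset.range n) m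
    (fun k => sortedGap_nonneg k) S (eq_sortedBottom_add_sum (x s)) hT
  -- The constant `m` thus contributes equally before and after the step, which leaves one
  -- inequality per cut.
  have hperm : ∑ i, ρ ^ (e i : ℕ) = ∑ i, ρ ^ (f i : ℕ) :=
    (Equiv.sum_comp e fun r : Fin n => ρ ^ (r : ℕ)).trans
      (Equiv.sum_comp f fun r : Fin n => ρ ^ (r : ℕ)).symm
  have hexpand : ∀ (h : Equiv.Perm (Fin n)) (l : ℕ → Fin n → ℝ),
      ∑ i, ρ ^ (h i : ℕ) * (m + ∑ k ∈ Finset.range n, g k * l k i)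
        = (∑ i, ρ ^ (h i : ℕ)) * m
          + ∑ k ∈ Finset.range n, g k * ∑ i, ρ ^ (h i : ℕ) * l k i := by
    intro h l
    simp_rw [mul_add, Finset.sum_add_distrib, Finset.sum_mul, Finset.mul_sum]
    congr 1
    rw [Finset.sum_comm]
    exact Finset.sum_congr rfl fun k _ => Finset.sum_congr rfl fun i _ => by ring
  have hs : rankWeightedSum (x s) ρ = (∑ i, ρ ^ (f i : ℕ)) * m
      + ∑ k ∈ Finset.range n, g k * ∑ i ∈ (S k)ᶜ, ρ ^ (f i : ℕ) := by
    have h1 : rankWeightedSum (x s) ρ = ∑ i, ρ ^ (f i : ℕ) *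
        (m + ∑ k ∈ Finset.range n, g k * if i ∈ S k then 0 else 1) :=
      Finset.sum_congr rfl fun i _ => congrArg _ (eq_sortedBottom_add_sum (x s) i)
    rw [h1, hexpand f fun k i => if i ∈ S k then 0 else 1]
    congr 1
    refine Finset.sum_congr rfl fun k _ => ?_
    congr 1
    rw [← Finset.sum_add_sum_compl (S k)]
    rw [Finset.sum_eq_zero fun i hi => by rw [if_pos hi, mul_zero], zero_add]
    exact Finset.sum_congr rfl fun i hi => by rw [if_neg (Finset.mem_compl.1 hi), mul_one]
  have hTge : (∑ i, ρ ^ (e i : ℕ)) * m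
      + ∑ k ∈ Finset.range n, g k * ∑ i, ρ ^ (e i : ℕ) * cutBarrier a (S k) s i T
      ≤ rankWeightedSum (x T) ρ := by
    rw [← hexpand e fun k i => cutBarrier a (S k) s i T]
    exact Finset.sum_le_sum fun i _ => mul_le_mul_of_nonneg_left (hlow i) (by positivity)
  have hstep : ∀ k ∈ Finset.range n,
      g k * (c * ∑ i ∈ S k, ∑ j ∈ (S k)ᶜ, ∫ u in s..T, a i j u) +
        g k * ∑ i ∈ (S k)ᶜ, ρ ^ (f i : ℕ)
      ≤ g k * ∑ i, ρ ^ (e i : ℕ) * cutBarrier a (S k) s i T := by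
    intro k hk
    rw [← mul_add]
    refine mul_le_mul_of_nonneg_left ?_ (sortedGap_nonneg k)
    exact cut_le_sum_rank_weight
      (fun i j => intervalIntegral.integral_nonneg hsT fun u hu => hw i j u hu) hK
      (Real.exp_pos _) hρ hρ1 hnρ hnK hL e f (Finset.mem_range.1 hk) (fun i => mem_lowerCut)
      (hcut (S k)) (fun i => cutBarrier_nonneg hw (S k) i hT)
      (fun i hi => le_cutBarrier_of_mem hw hi hT hL)
      (fun i hi => one_sub_cutIntegral_le_cutBarrier hw hint hi hT)
      (fun i hi => le_cutBarrier_of_notMem hw hi hT hL)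
  have hsum := Finset.sum_le_sum hstep
  rw [Finset.sum_add_distrib] at hsum
  have hflow : c * gapFlow (x s) (fun i j => ∫ u in s..T, a i j u)
      = ∑ k ∈ Finset.range n, g k * (c * ∑ i ∈ S k, ∑ j ∈ (S k)ᶜ, ∫ u in s..T, a i j u) := by
    rw [gapFlow, Finset.mul_sum]
    exact Finset.sum_congr rfl fun k _ => by ring
  rw [hflow, hs, ← hperm]
  linarith

end Step

/-! ### Convergence and the persistent graph -/

section Convergence

variable {n : ℕ} {a : Fin n → Fin n → ℝ → ℝ} {x : ℝ → Fin n → ℝ} {t : ℕ → ℝ} {K M : ℝ}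

theorem IsInteractionWeights.intervalIntegrable (ha : IsInteractionWeights a) (i j : Fin n)
    {s T : ℝ} (hs : 0 ≤ s) (hsT : s ≤ T) : IntervalIntegrable (a i j) volume s T := by
  rw [intervalIntegrable_iff_integrableOn_Icc_of_le hsT]
  exact (ha.integrableOn i j T (hs.trans hsT)).mono_set (Set.Icc_subset_Icc_left hs)

theorem IsInteractionWeights.nonneg_of_mem_Icc (ha : IsInteractionWeights a) {s T : ℝ}
    (hs : 0 ≤ s) (i j : Fin n) (u : ℝ) (hu : u ∈ Set.Icc s T) : 0 ≤ a i j u :=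
  ha.nonneg i j u (hs.trans hu.1)

theorem IsInteractionWeights.integral_nonneg (ha : IsInteractionWeights a) (i j : Fin n)
    {s T : ℝ} (hs : 0 ≤ s) (hsT : s ≤ T) : 0 ≤ ∫ u in s..T, a i j u :=
  intervalIntegral.integral_nonneg hsT fun u hu => ha.nonneg_of_mem_Icc hs i j u hu

theorem IsTrajectory.hasAEDerivOn (hx : IsTrajectory a x) {s T : ℝ} (hs : 0 ≤ s) (hsT : s ≤ T)
    (i : Fin n) :
    HasAEDerivOn (fun t => x t i) (fun t => ∑ j, a i j t * (x t j - x t i)) s T := by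
  have hT := hs.trans hsT
  have h := (HasAEDerivOn.const (x 0 i)).add (HasAEDerivOn.integral (hx i T hT).1 hT)
  simp only [zero_add] at h
  exact (h.congr hT fun u hu => (hx i u hu.1).2).mono hs hsT le_rfl

theorem IsTrajectory.neg (hx : IsTrajectory a x) : IsTrajectory a fun t => -x t := by
  intro i u hu
  have heq : (fun s => ∑ j, a i j s * ((-x s) j - (-x s) i))
      = fun s => -∑ j, a i j s * (x s j - x s i) := by
    ext s
    rw [← Finset.sum_neg_distrib]
    exact Finset.sum_congr rfl fun j _ => by simp only [Pi.neg_apply]; ring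
  rw [heq, intervalIntegral.integral_neg]
  refine ⟨(hx i u hu).1.neg, ?_⟩
  simp only [Pi.neg_apply]
  rw [(hx i u hu).2]
  ring

/-- Comparison applied to a constant minus the trajectory, which also solves the dynamics. -/
theorem IsTrajectory.le_sum_abs (ha : IsInteractionWeights a) (hx : IsTrajectory a x)
    {u : ℝ} (hu : 0 ≤ u) (i : Fin n) : x u i ≤ ∑ j, |x 0 j| := by
  rw [← sub_nonneg]
  refine consensus_supersolution_nonneg (a := a) (y := fun i u => ∑ j, |x 0 j| - x u i) hu
    (ha.nonneg_of_mem_Icc le_rfl) (fun i j => ha.intervalIntegrable i j le_rfl hu)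
    (fun i => (HasAEDerivOn.const _).sub (hx.hasAEDerivOn le_rfl hu i))
    (fun i => Eventually.of_forall fun r _ => ?_) (fun i => ?_) ⟨hu, le_rfl⟩ i
  · rw [zero_sub, ← Finset.sum_neg_distrib]
    exact Finset.sum_le_sum fun j _ => le_of_eq (by ring)
  · exact sub_nonneg.2 ((le_abs_self _).trans
      (Finset.single_le_sum (f := fun j => |x 0 j|) (fun j _ => abs_nonneg _) (Finset.mem_univ i)))

theorem IsTrajectory.abs_le_sum_abs (ha : IsInteractionWeights a) (hx : IsTrajectory a x)
    {u : ℝ} (hu : 0 ≤ u) (i : Fin n) : |x u i| ≤ ∑ j, |x 0 j| := by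
  refine abs_le.2 ⟨?_, hx.le_sum_abs ha hu i⟩
  have := hx.neg.le_sum_abs ha hu i
  simp only [Pi.neg_apply, abs_neg] at this
  linarith

theorem IntegralReciprocity.cutIntegral_le (hK : IntegralReciprocity a t K) (p : ℕ)
    (S : Finset (Fin n)) :
    cutIntegral a Sᶜ S (t p) (t (p + 1)) ≤ K * cutIntegral a S Sᶜ (t p) (t (p + 1)) := by
  rcases S.eq_empty_or_nonempty with rfl | hS
  · simp [cutIntegral]
  by_cases hu : S = Finset.univ
  · simp [cutIntegral, hu]
  have h := hK.cut_balance Sᶜ (by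
    rw [Finset.nonempty_iff_ne_empty, ne_eq, Finset.compl_eq_empty_iff]; exact hu)
    (by rw [ne_eq, Finset.compl_eq_univ_iff]; exact hS.ne_empty) p
  rw [compl_compl] at h
  refine h.trans_eq ?_
  rw [cutIntegral, Finset.sum_comm]

theorem exists_pos_weight_ratio (n : ℕ) {ε K : ℝ} (hε : 0 < ε) (hK : 1 ≤ K) :
    ∃ ρ : ℝ, 0 < ρ ∧ ρ ≤ 1 ∧ n * ρ ≤ ε / 2 ∧ n * ρ * K ≤ ε / 2 := by
  have hK0 : 0 < K := by linarith
  refine ⟨min 1 (ε / (2 * (n + 1) * K)), lt_min one_pos (by positivity), min_le_left _ _, ?_⟩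
  set ρ := min 1 (ε / (2 * (n + 1) * K))
  have hρ0 : 0 ≤ ρ := le_min zero_le_one (by positivity)
  have h1 : ρ * (2 * (n + 1) * K) ≤ ε := (le_div_iff₀ (by positivity)).1 (min_le_right _ _)
  have h2 : 0 ≤ ρ * K := mul_nonneg hρ0 hK0.le
  have h3 : n * ρ * K ≤ ε / 2 := by nlinarith
  refine ⟨le_trans ?_ h3, h3⟩
  exact le_mul_of_one_le_right (by positivity) hK

/-- The one-step increases telescope, and the weighted sum is bounded because the trajectory is. -/
theorem IsTrajectory.summable_gapFlow (ha : IsInteractionWeights a) (hx : IsTrajectory a x)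
    (hK : IntegralReciprocity a t K) (hM : IntegralWeightsBounded a t M) :
    Summable fun p => gapFlow (x (t p)) fun i j => ∫ u in (t p)..(t (p + 1)), a i j u := by
  have hK0 : 0 ≤ K := zero_le_one.trans hK.one_le
  have hle : ∀ p, t p ≤ t (p + 1) := fun p => hK.time_mono p.le_succ
  set L : ℝ := ∑ _i : Fin n, ∑ _j : Fin n, M
  have hL : ∀ p, cutIntegral a Finset.univ Finset.univ (t p) (t (p + 1)) ≤ L := fun p =>
    Finset.sum_le_sum fun i _ => Finset.sum_le_sum fun j _ => hM i j p
  -- No sign is assumed for `M`; it is the nonnegative total weight that forces `L ≥ 0`.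
  have hL0 : 0 ≤ L :=
    (cutIntegral_nonneg (ha.nonneg_of_mem_Icc (hK.time_nonneg 0)) _ _ ⟨hle 0, le_rfl⟩).trans (hL 0)
  obtain ⟨ρ, hρ, hρ1, hnρ, hnK⟩ := exists_pos_weight_ratio n (Real.exp_pos (-2 * L)) hK.one_le
  set c := ρ ^ n * Real.exp (-2 * L) / (2 * (L + 1))
  have hc : 0 < c := by positivity
  set D : ℕ → ℝ := fun p => gapFlow (x (t p)) fun i j => ∫ u in (t p)..(t (p + 1)), a i j u
  have hstep : ∀ p, c * D p + rankWeightedSum (x (t p)) ρ ≤ rankWeightedSum (x (t (p + 1))) ρ :=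
    fun p => gapFlow_add_rankWeightedSum_le (hle p) (ha.nonneg_of_mem_Icc (hK.time_nonneg p))
      (fun i j => ha.intervalIntegrable i j (hK.time_nonneg p) (hle p))
      (hx.hasAEDerivOn (hK.time_nonneg p) (hle p)) hK0 (hK.cutIntegral_le p) (hL p) hρ hρ1 hnρ hnK
  have htel : ∀ N, c * ∑ p ∈ Finset.range N, D p + rankWeightedSum (x (t 0)) ρ
      ≤ rankWeightedSum (x (t N)) ρ := by
    intro N
    induction N with
    | zero => simp
    | succ N ih =>
      rw [Finset.sum_range_succ, mul_add]
      linarith [hstep N]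
  have hbound : ∀ p, |rankWeightedSum (x (t p)) ρ| ≤ n * ∑ j, |x 0 j| := fun p =>
    abs_rankWeightedSum_le hρ.le hρ1 fun i => hx.abs_le_sum_abs ha (hK.time_nonneg p) i
  refine summable_of_sum_range_le (c := (2 * (n * ∑ j, |x 0 j|)) / c)
    (fun p => gapFlow_nonneg fun i j => ha.integral_nonneg i j (hK.time_nonneg p) (hle p))
    fun N => ?_
  rw [le_div_iff₀ hc]
  have h1 := (abs_le.1 (hbound N)).2
  have h2 := (abs_le.1 (hbound 0)).1
  linarith [htel N]

/-- The lower bound `sub_gapFlow_le` is one-sided; applied to `-x`, it also gives the upper bound.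
-/
theorem IsTrajectory.exists_summable_bound (ha : IsInteractionWeights a) (hx : IsTrajectory a x)
    (hK : IntegralReciprocity a t K) (hM : IntegralWeightsBounded a t M) :
    ∃ d : ℕ → ℝ, Summable d ∧
      (∀ p i u, u ∈ Set.Icc (t p) (t (p + 1)) → |x u i - x (t p) i| ≤ d p) ∧
      ∀ p i j, (∫ u in (t p)..(t (p + 1)), a i j u) * |x (t p) i - x (t p) j| ≤ d p := by
  have hK0 : 0 ≤ K := zero_le_one.trans hK.one_le
  have hle : ∀ p, t p ≤ t (p + 1) := fun p => hK.time_mono p.le_succ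
  set D : (ℝ → Fin n → ℝ) → ℕ → ℝ := fun y p =>
    gapFlow (y (t p)) fun i j => ∫ u in (t p)..(t (p + 1)), a i j u
  have hD0 : ∀ y p, 0 ≤ D y p := fun y p =>
    gapFlow_nonneg fun i j => ha.integral_nonneg i j (hK.time_nonneg p) (hle p)
  have hlow : ∀ y, IsTrajectory a y → ∀ p i u, u ∈ Set.Icc (t p) (t (p + 1)) →
      y (t p) i - K * D y p ≤ y u i := fun y hy p i u hu =>
    sub_gapFlow_le (hle p) (ha.nonneg_of_mem_Icc (hK.time_nonneg p))
      (fun i j => ha.intervalIntegrable i j (hK.time_nonneg p) (hle p))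
      (hy.hasAEDerivOn (hK.time_nonneg p) (hle p)) hK0 (hK.cutIntegral_le p) hu i
  refine ⟨fun p => (1 + K) * (D x p + D (fun u => -x u) p),
    ((hx.summable_gapFlow ha hK hM).add (hx.neg.summable_gapFlow ha hK hM)).mul_left _,
    fun p i u hu => ?_, fun p i j => ?_⟩
  · have h1 := hlow x hx p i u hu
    have h2 := hlow _ hx.neg p i u hu
    have h3 := hD0 x p
    have h4 := hD0 (fun u => -x u) p
    have h5 := mul_nonneg hK0 h3
    have h6 := mul_nonneg hK0 h4
    simp only [Pi.neg_apply] at h2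
    rw [abs_le]
    constructor <;> linarith
  · refine (mul_abs_sub_le_gapFlow (v := x (t p))
      (A := fun i j => ∫ u in (t p)..(t (p + 1)), a i j u)
      (fun i j => ha.integral_nonneg i j (hK.time_nonneg p) (hle p)) hK0
      (hK.cutIntegral_le p) i j).trans ?_
    exact mul_le_mul_of_nonneg_left (le_add_of_nonneg_right (hD0 (fun u => -x u) p)) (by linarith)

theorem tendsto_of_summable_oscillation {f : ℝ → ℝ} (ht : Tendsto t atTop atTop)
    {d : ℕ → ℝ} (hd : Summable d)
    (hosc : ∀ p u, u ∈ Set.Icc (t p) (t (p + 1)) → |f u - f (t p)| ≤ d p) (hmono : Monotone t) :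
    ∃ l, Tendsto f atTop (𝓝 l) := by
  have hcauchy : CauchySeq fun p => f (t p) :=
    cauchySeq_of_dist_le_of_summable d (fun p => by
      rw [dist_comm]
      exact hosc p _ ⟨hmono p.le_succ, le_rfl⟩) hd
  obtain ⟨l, hl⟩ := cauchySeq_tendsto_of_complete hcauchy
  refine ⟨l, Metric.tendsto_atTop.2 fun ε hε => ?_⟩
  obtain ⟨P, hP⟩ := Metric.tendsto_atTop.1 hl (ε / 2) (half_pos hε)
  obtain ⟨Q, hQ⟩ := Metric.tendsto_atTop.1 hd.tendsto_atTop_zero (ε / 2) (half_pos hε)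
  refine ⟨t (max P Q), fun u hu => ?_⟩
  have hex : ∃ p, u < t p := (ht.eventually_gt_atTop u).exists
  classical
  -- The first `t p` beyond `u` has a predecessor, so `u` lies in some `[t q, t (q + 1)]` with `q ≥
  -- max P Q`.
  obtain ⟨q, hq⟩ : ∃ q, Nat.find hex = q + 1 := Nat.exists_eq_succ_of_ne_zero fun h0 => by
    have h1 := Nat.find_spec hex
    rw [h0] at h1
    exact absurd (h1.trans_le (hmono (Nat.zero_le (max P Q)))) (not_lt.2 hu)
  have hlt : u < t (q + 1) := hq ▸ Nat.find_spec hex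
  have hge : t q ≤ u := not_lt.1 (Nat.find_min hex (hq ▸ q.lt_succ_self))
  have hmax : max P Q ≤ q := by
    by_contra! h
    exact absurd (hlt.trans_le (hmono h)) (not_lt.2 hu)
  have h1 := hP q ((le_max_left _ _).trans hmax)
  have h2 := hQ q ((le_max_right _ _).trans hmax)
  rw [Real.dist_eq] at h1 h2 ⊢
  rw [sub_zero] at h2
  have h3 := (hosc q u ⟨hge, hlt.le⟩).trans (le_abs_self _)
  calc |f u - l| ≤ |f u - f (t q)| + |f (t q) - l| := abs_sub_le _ _ _
    _ < ε := by linarith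

theorem IsTrajectory.exists_tendsto_apply (ha : IsInteractionWeights a) (hx : IsTrajectory a x)
    (hK : IntegralReciprocity a t K) (hM : IntegralWeightsBounded a t M) (i : Fin n) :
    ∃ l, Tendsto (fun u => x u i) atTop (𝓝 l) := by
  obtain ⟨d, hd, hosc, -⟩ := hx.exists_summable_bound ha hK hM
  exact tendsto_of_summable_oscillation hK.time_tendsto hd (fun p u hu => hosc p i u hu)
    hK.time_mono

theorem persistentGraph_adj_iff (ha : IsInteractionWeights a) (hmono : Monotone t)
    (h0 : ∀ p, 0 ≤ t p) (ht : Tendsto t atTop atTop) (i j : Fin n) :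
    (persistentGraph a).Adj j i ↔ ¬ Summable fun p => ∫ u in (t p)..(t (p + 1)), a i j u := by
  have hae : 0 ≤ᵐ[volume.restrict (Set.Ici (0 : ℝ))] a i j :=
    (ae_restrict_iff' measurableSet_Ici).2 (Eventually.of_forall fun u hu => ha.nonneg i j u hu)
  have hadj : (persistentGraph a).Adj j i ↔ ¬ IntegrableOn (a i j) (Set.Ici 0) := by
    rw [IntegrableOn, Integrable, hasFiniteIntegral_iff_ofReal hae,
      and_iff_right (ha.measurable i j).aestronglyMeasurable, not_lt_top_iff]
    rfl
  have hsum : ∀ N, ∑ p ∈ Finset.range N, ∫ u in (t p)..(t (p + 1)), a i j u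
      = ∫ u in (t 0)..(t N), a i j u := fun N =>
    intervalIntegral.sum_integral_adjacent_intervals fun p _ =>
      ha.intervalIntegrable i j (h0 p) (hmono p.le_succ)
  rw [hadj, not_iff_not]
  constructor
  · intro hint
    refine summable_of_sum_range_le (c := ∫ u in Set.Ici (0 : ℝ), a i j u)
      (fun p => ha.integral_nonneg i j (h0 p) (hmono p.le_succ)) fun N => ?_
    rw [hsum, intervalIntegral.integral_of_le (hmono N.zero_le)]
    refine setIntegral_mono_set hint hae (Eventually.of_forall fun u hu => ?_)
    exact (h0 0).trans (le_of_lt hu.1)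
  · intro hs
    rw [integrableOn_Ici_iff_integrableOn_Ioi]
    refine integrableOn_Ioi_of_intervalIntegral_norm_bounded
      ((∫ u in (0 : ℝ)..(t 0), a i j u) + ∑' p, ∫ u in (t p)..(t (p + 1)), a i j u) 0
      (fun p => (ha.integrableOn i j (t p) (h0 p)).mono_set Set.Ioc_subset_Icc_self) ht
      (Eventually.of_forall fun N => ?_)
    have hnorm : ∫ u in (0 : ℝ)..(t N), ‖a i j u‖ = ∫ u in (0 : ℝ)..(t N), a i j u := by
      refine intervalIntegral.integral_congr fun u hu => ?_
      rw [Set.uIcc_of_le (h0 N)] at hu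
      exact Real.norm_of_nonneg (ha.nonneg i j u hu.1)
    rw [hnorm, ← intervalIntegral.integral_add_adjacent_intervals
      (ha.intervalIntegrable i j le_rfl (h0 0))
      (ha.intervalIntegrable i j (h0 0) (hmono N.zero_le)), ← hsum]
    exact add_le_add le_rfl (hs.sum_le_tsum _ fun p _ =>
      ha.integral_nonneg i j (h0 p) (hmono p.le_succ))

/-- No edge leaves the set `S` reachable from `j`, so its outgoing integral weights are summable. By
reciprocity so are the incoming ones; hence no edge enters `S`, and a path from outside cannot reach
`j`. -/
theorem HasDirectedPath.symm_of_reciprocity (ha : IsInteractionWeights a)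
    (hK : IntegralReciprocity a t K) {i j : Fin n}
    (hij : HasDirectedPath (persistentGraph a) i j) :
    HasDirectedPath (persistentGraph a) j i := by
  classical
  by_contra hji
  have hadj := persistentGraph_adj_iff ha hK.time_mono hK.time_nonneg hK.time_tendsto
  set S : Finset (Fin n) := Finset.univ.filter fun v => HasDirectedPath (persistentGraph a) j v
  have hS : ∀ v, v ∈ S ↔ HasDirectedPath (persistentGraph a) j v := fun v => by simp [S]
  have hjS : j ∈ S := (hS j).2 Relation.ReflTransGen.refl
  have hiS : i ∉ S := fun h => hji ((hS i).1 h)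
  have hout : ∀ v ∈ S, ∀ u ∈ Sᶜ, Summable fun p => ∫ r in (t p)..(t (p + 1)), a u v r := by
    intro v hv u hu
    by_contra hns
    refine Finset.mem_compl.1 hu ((hS u).2 ?_)
    exact Relation.ReflTransGen.tail ((hS v).1 hv) ((hadj u v).2 hns)
  have hsum : Summable fun p => K * ∑ v ∈ S, ∑ u ∈ Sᶜ, ∫ r in (t p)..(t (p + 1)), a u v r :=
    (summable_sum fun v hv => summable_sum fun u hu => hout v hv u hu).mul_left K
  have hnoedge : ∀ v ∈ S, ∀ u ∉ S, ¬ (persistentGraph a).Adj u v := by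
    intro v hv u hu
    rw [hadj v u, not_not]
    have hA : ∀ p i j, 0 ≤ ∫ r in (t p)..(t (p + 1)), a i j r := fun p i j =>
      ha.integral_nonneg i j (hK.time_nonneg p) (hK.time_mono p.le_succ)
    refine hsum.of_nonneg_of_le (fun p => hA p v u) fun p => ?_
    refine le_trans ?_ (hK.cut_balance S ⟨j, hjS⟩
      (fun h => hiS (h ▸ Finset.mem_univ i)) p)
    simpa using Finset.sum_sum_le_sum_sum_of_subset (Finset.singleton_subset_iff.2 hv)
      (Finset.singleton_subset_iff.2 (Finset.mem_compl.2 hu)) (hA p)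
  have hstay : ∀ w, HasDirectedPath (persistentGraph a) i w → w ∉ S := by
    intro w hw
    induction hw with
    | refl => exact hiS
    | tail _ hbc ih => exact fun hc => hnoedge _ hc _ ih hbc
  exact hstay j hij hjS

/-- With distinct limits, `|x_i - x_j|` would eventually exceed half their distance, and the
summable bound on weight times difference would make the weights summable. -/
theorem IsTrajectory.limit_eq_of_adj (ha : IsInteractionWeights a) (hx : IsTrajectory a x)
    (hK : IntegralReciprocity a t K) (hM : IntegralWeightsBounded a t M) {i j : Fin n}
    (hadj : (persistentGraph a).Adj j i) {li lj : ℝ}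
    (hi : Tendsto (fun u => x u i) atTop (𝓝 li)) (hj : Tendsto (fun u => x u j) atTop (𝓝 lj)) :
    li = lj := by
  by_contra hne
  rw [persistentGraph_adj_iff ha hK.time_mono hK.time_nonneg hK.time_tendsto] at hadj
  obtain ⟨d, hd, -, hflow⟩ := hx.exists_summable_bound ha hK hM
  refine hadj ?_
  have hδ : 0 < |li - lj| := abs_pos.2 (sub_ne_zero.2 hne)
  have hlim := ((hi.sub hj).abs.comp hK.time_tendsto).eventually_const_lt (half_lt_self hδ)
  refine (hd.mul_left (2 / |li - lj|)).of_norm_bounded_eventually_nat ?_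
  filter_upwards [hlim] with p hp
  have hA := ha.integral_nonneg i j (hK.time_nonneg p) (hK.time_mono p.le_succ)
  rw [Real.norm_of_nonneg hA, div_mul_eq_mul_div, le_div_iff₀ hδ]
  have h1 := mul_le_mul_of_nonneg_left hp.le hA
  simp only [Function.comp_apply] at h1
  linarith [hflow p i j]

end Convergence

theorem theorem1 {n : ℕ} (a : Fin n → Fin n → ℝ → ℝ) (ha : IsInteractionWeights a)
    (t : ℕ → ℝ) (K M : ℝ) (hK : IntegralReciprocity a t K) (hM : IntegralWeightsBounded a t M) :
    (∀ x : ℝ → Fin n → ℝ, IsTrajectory a x →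
      ∃ xstar : Fin n → ℝ, Tendsto x atTop (𝓝 xstar)) ∧
    ∀ i j : Fin n,
      (HasDirectedPath (persistentGraph a) i j ↔ HasDirectedPath (persistentGraph a) j i) ∧
      (HasDirectedPath (persistentGraph a) i j →
        ∀ x : ℝ → Fin n → ℝ, IsTrajectory a x →
          ∃ l : ℝ, Tendsto (fun s => x s i) atTop (𝓝 l) ∧
            Tendsto (fun s => x s j) atTop (𝓝 l)) := by
  refine ⟨fun x hx => ?_, fun i j => ⟨⟨fun h => h.symm_of_reciprocity ha hK,
    fun h => h.symm_of_reciprocity ha hK⟩, fun hij x hx => ?_⟩⟩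
  · choose l hl using hx.exists_tendsto_apply ha hK hM
    exact ⟨l, tendsto_pi_nhds.2 hl⟩
  · obtain ⟨l, hl⟩ := hx.exists_tendsto_apply ha hK hM i
    refine ⟨l, hl, ?_⟩
    induction hij with
    | refl => exact hl
    | tail _ hbc ih =>
      obtain ⟨l', hl'⟩ := hx.exists_tendsto_apply ha hK hM _
      exact hx.limit_eq_of_adj ha hK hM hbc hl' ih ▸ hl'
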